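/- Let $p$ be a prime and let $G$ be a finite $p$-group. Let $$e := \mathrm{ge}(G) := \min_S\ \mathrm{lcm}\{\mathrm{ord}(x) \mid x\in S\},$$ where $S$ ranges over all generating subsets of $G$, be the generator exponent of $G$, and let $c$ be the nilpotency class of $G$. If $c\le p$, then the exponent of the commutator subgroup $G'=[G,G]$ divides $e$. -/

import Mathlib

/-- The generator exponent `ge(G) = min_S lcm {ord(x) | x ∈ S}` of a finite group `G`, where `S`
ranges over all generating subsets of `G`. As `G` is finite, its subsets are its finsets, and the
set of values is nonempty, so that the infimum is a minimum. -/
noncomputable def generatorExponent (G : Type*) [Group G] [Finite G] : ℕ :=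
  sInf {n : ℕ | ∃ S : Finset G, Subgroup.closure (S : Set G) = ⊤ ∧ n = S.lcm orderOf}

/-- The minimum is attained. -/
theorem exists_generatorExponent_eq (G : Type*) [Group G] [Finite G] :
    ∃ S : Finset G, Subgroup.closure (S : Set G) = ⊤ ∧ generatorExponent G = S.lcm orderOf := by
  have hne : {n : ℕ | ∃ S : Finset G,
      Subgroup.closure (S : Set G) = ⊤ ∧ n = S.lcm orderOf}.Nonempty :=
    ⟨_, (Set.toFinite (Set.univ : Set G)).toFinset, by simp, rfl⟩
  exact Nat.sInf_mem hne

theorem generatorExponent_pos (G : Type*) [Group G] [Finite G] : 0 < generatorExponent G := by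
  obtain ⟨S, -, h⟩ := exists_generatorExponent_eq G
  rw [h, Nat.pos_iff_ne_zero, Ne, Finset.lcm_eq_zero_iff]
  rintro ⟨x, -, hx⟩
  exact (orderOf_pos x).ne' hx

/-! The proof bounds, for a prime power `q = p ^ k` and a subgroup `K` of nilpotency class `c`
generated by a set `S` of elements with `x ^ q = 1`, the exponents of `K` and `⁅K, K⁆`: if `c < p`
then `K` has exponent dividing `q`, and if `c ≤ p` then `⁅K, K⁆` does. Both are proved together by
induction on `c` (`pow_eq_one_of_mem_closure`).

* The second claim for class `c + 1` follows from the first for class `c`. For `x ∈ S` and `g ∈ K`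
  the commutator `⁅g, x⁆ = (g * x * g⁻¹) * x⁻¹` lies in the subgroup generated by a conjugate of
  `x` and `x⁻¹`, inside `⟨x⟩⁅K, K⁆`, whose class is smaller than that of `K`
  (`lowerCentralSeries_zpowers_sup_le`). So `⁅g, x⁆ ^ q = 1`; these commutators generate `⁅K, K⁆`,
  whose class is smaller too.
* The first claim for class `c` follows from the second for class `c`, by the identity
  `(a * b) ^ q = a ^ q * b ^ q`, valid when `⁅K, K⁆` has exponent dividing `q` and `c < p`. This is
  a consequence of Hall's collection formula, obtained here without collecting: the sequence
  `n ↦ b⁻ⁿ * a⁻ⁿ * (a * b)ⁿ` is polynomial with respect to the lower central series, since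
  polynomial sequences are closed under products, inverses and commutators
  (`isPolySeq_mul_inv_commutator`, a theorem of Lazard and Leibman). It is trivial at `0` and `1`,
  so it is a product of sequences `n ↦ g ^ n.choose m` with `2 ≤ m < p` and `g` in the `m`-th term
  of the lower central series, and `q ∣ q.choose m` (`IsPolySeq.apply_prime_pow_eq_one`).
-/

open scoped commutatorElement

/-! ### Commutators of terms of the lower central series -/

theorem commutator_commutator_le_of_rotate {G : Type*} [Group G] {A B C N : Subgroup G} [N.Normal]
    (h₁ : ⁅⁅B, C⁆, A⁆ ≤ N) (h₂ : ⁅⁅C, A⁆, B⁆ ≤ N) : ⁅⁅A, B⁆, C⁆ ≤ N := by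
  have key : ∀ X : Subgroup G, X ≤ N ↔ X.map (QuotientGroup.mk' N) = ⊥ := fun X => by
    rw [Subgroup.map_eq_bot_iff, QuotientGroup.ker_mk']
  rw [key] at h₁ h₂ ⊢
  simp only [Subgroup.map_commutator] at h₁ h₂ ⊢
  exact Subgroup.commutator_commutator_eq_bot_of_rotate h₁ h₂

theorem commutator_top_lowerCentralSeries_le (G : Type*) [Group G] (m n : ℕ) :
    ⁅(⊤ : Subgroup G).lowerCentralSeries m, (⊤ : Subgroup G).lowerCentralSeries n⁆ ≤
      (⊤ : Subgroup G).lowerCentralSeries (m + n + 1) := by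
  induction n generalizing m with
  | zero => exact le_rfl
  | succ n ih =>
    rw [Subgroup.commutator_comm]
    refine commutator_commutator_le_of_rotate ?_ ?_
    · rw [Subgroup.commutator_comm ⊤]
      refine (ih (m + 1)).trans (le_of_eq ?_)
      congr 1
      omega
    · exact Subgroup.commutator_mono (ih m) le_rfl

theorem map_subtype_top_lowerCentralSeries {G : Type*} [Group G] (K : Subgroup G) (n : ℕ) :
    ((⊤ : Subgroup K).lowerCentralSeries n).map K.subtype = K.lowerCentralSeries n := by
  rw [Subgroup.map_lowerCentralSeries, ← MonoidHom.range_eq_map, Subgroup.range_subtype]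

theorem commutator_lowerCentralSeries_le {G : Type*} [Group G] (K : Subgroup G) (m n : ℕ) :
    ⁅K.lowerCentralSeries m, K.lowerCentralSeries n⁆ ≤ K.lowerCentralSeries (m + n + 1) := by
  simp only [← map_subtype_top_lowerCentralSeries K, ← Subgroup.map_commutator]
  exact Subgroup.map_mono (commutator_top_lowerCentralSeries_le K m n)

theorem commutator_zpowers_sup_top_le {G : Type*} [Group G] (x : G) :
    ⁅Subgroup.zpowers x ⊔ commutator G, Subgroup.zpowers x ⊔ commutator G⁆ ≤
      (⊤ : Subgroup G).lowerCentralSeries 2 := by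
  set N := (⊤ : Subgroup G).lowerCentralSeries 2
  have hN : N.Normal := inferInstance
  have hl : ∀ u ∈ commutator G, ∀ g, ⁅u, g⁆ ∈ N := fun u hu g =>
    Subgroup.commutator_mem_commutator hu (Subgroup.mem_top g)
  have hr : ∀ u ∈ commutator G, ∀ g, ⁅g, u⁆ ∈ N := fun u hu g => by
    rw [← commutatorElement_inv]
    exact N.inv_mem (hl u hu g)
  rw [Subgroup.commutator_le]
  intro y hy z hz
  obtain ⟨y', ⟨i, rfl⟩, u, hu, rfl⟩ := Subgroup.mem_sup_of_normal_right.mp hy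
  obtain ⟨z', ⟨j, rfl⟩, v, hv, rfl⟩ := Subgroup.mem_sup_of_normal_right.mp hz
  have hij : ⁅x ^ i, x ^ j⁆ = 1 := ((Commute.refl x).zpow_zpow i j).commutator_eq
  have key : ⁅x ^ i * u, x ^ j * v⁆ = (x ^ i * ⁅u, x ^ j * v⁆ * (x ^ i)⁻¹) *
      (⁅x ^ i, x ^ j⁆ * (x ^ j * ⁅x ^ i, v⁆ * (x ^ j)⁻¹)) := by
    simp only [commutatorElement_def]
    group
  change ⁅x ^ i * u, x ^ j * v⁆ ∈ N
  rw [key, hij, one_mul]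
  exact N.mul_mem (hN.conj_mem _ (hl u hu _) _) (hN.conj_mem _ (hr v hv _) _)

/-- The subgroup `⟨x⟩⁅K, K⁆` of `K` has smaller nilpotency class than `K`, unless `K` is abelian. -/
theorem lowerCentralSeries_zpowers_sup_le {G : Type*} [Group G] {K : Subgroup G} {x : G}
    (hx : x ∈ K) (n : ℕ) :
    (Subgroup.zpowers x ⊔ ⁅K, K⁆).lowerCentralSeries (n + 1) ≤ K.lowerCentralSeries (n + 2) := by
  induction n with
  | zero =>
    have h := Subgroup.map_mono (f := K.subtype) (commutator_zpowers_sup_top_le (⟨x, hx⟩ : K))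
    rw [map_subtype_top_lowerCentralSeries, Subgroup.map_commutator, Subgroup.map_sup,
      MonoidHom.map_zpowers, Subgroup.map_subtype_commutator] at h
    exact h
  | succ n ih =>
    refine Subgroup.commutator_mono ih (sup_le ?_ K.commutator_le_self)
    rwa [Subgroup.zpowers_le]

/-! ### Polynomial sequences in a filtered group -/

/-- `IsPolySeq H k i f` says that the difference derivatives of `f : ℕ → G` of order `m ≤ k` take
values in `H (i + m)`, where the difference derivative of `f` is `n ↦ (f n)⁻¹ * f (n + 1)`. A
sequence is polynomial with respect to the filtration `H` if this holds for `i = 0` and all `k`. -/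
def IsPolySeq {G : Type*} [Group G] (H : ℕ → Subgroup G) : ℕ → ℕ → (ℕ → G) → Prop
  | 0, i, f => ∀ n, f n ∈ H i
  | k + 1, i, f => (∀ n, f n ∈ H i) ∧ IsPolySeq H k (i + 1) fun n => (f n)⁻¹ * f (n + 1)

section Filtration

variable {G : Type*} [Group G] {H : ℕ → Subgroup G}

theorem IsPolySeq.mem {k i : ℕ} {f : ℕ → G} (hf : IsPolySeq H k i f) (n : ℕ) : f n ∈ H i := by
  cases k with
  | zero => exact hf n
  | succ k => exact hf.1 n

theorem IsPolySeq.of_succ {k i : ℕ} {f : ℕ → G} (hf : IsPolySeq H (k + 1) i f) :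
    IsPolySeq H k i f := by
  induction k generalizing i f with
  | zero => exact hf.1
  | succ k ih => exact ⟨hf.1, ih hf.2⟩

theorem IsPolySeq.of_le (hH : Antitone H) {k i j : ℕ} (hij : i ≤ j) {f : ℕ → G}
    (hf : IsPolySeq H k j f) : IsPolySeq H k i f := by
  induction k generalizing i j f with
  | zero => exact fun n => hH hij (hf n)
  | succ k ih => exact ⟨fun n => hH hij (hf.1 n), ih (by omega) hf.2⟩

/-- The Lazard–Leibman theorem. The three closure properties have to be proved together: the
derivative of a product or an inverse involves conjugates, that is, commutators. -/
theorem isPolySeq_mul_inv_commutator (hH : Antitone H) (hc : ∀ i j, ⁅H i, H j⁆ ≤ H (i + j))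
    (k : ℕ) :
    (∀ i f g, IsPolySeq H k i f → IsPolySeq H k i g → IsPolySeq H k i fun n => f n * g n) ∧
    (∀ i f, IsPolySeq H k i f → IsPolySeq H k i fun n => (f n)⁻¹) ∧
    (∀ i j f g, IsPolySeq H k i f → IsPolySeq H k j g →
      IsPolySeq H k (i + j) fun n => ⁅f n, g n⁆) := by
  induction k with
  | zero =>
    exact ⟨fun i f g hf hg n => mul_mem (hf n) (hg n), fun i f hf n => inv_mem (hf n),
      fun i j f g hf hg n => hc i j (Subgroup.commutator_mem_commutator (hf n) (hg n))⟩
  | succ k ih =>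
    obtain ⟨ihm, ihi, ihc⟩ := ih
    have hconj : ∀ i j f g, IsPolySeq H k i f → IsPolySeq H k j g →
        IsPolySeq H k i fun n => g n * f n * (g n)⁻¹ := by
      intro i j f g hf hg
      have h := ihm i _ f ((ihc j i g f hg hf).of_le hH (by omega)) hf
      simpa [commutatorElement_def] using h
    have hconj' : ∀ i j f g, IsPolySeq H k i f → IsPolySeq H k j g →
        IsPolySeq H k i fun n => (g n)⁻¹ * f n * g n := by
      intro i j f g hf hg
      simpa using hconj i j f _ hf (ihi j g hg)
    refine ⟨?_, ?_, ?_⟩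
    · intro i f g hf hg
      refine ⟨fun n => mul_mem (hf.1 n) (hg.1 n), ?_⟩
      convert ihm _ _ _ (hconj' _ _ _ _ hf.2 hg.of_succ) hg.2 using 2 with n
      group
    · intro i f hf
      refine ⟨fun n => inv_mem (hf.1 n), ?_⟩
      convert hconj _ _ _ _ (ihi _ _ hf.2) hf.of_succ using 2 with n
      group
    · intro i j f g hf hg
      refine ⟨fun n => hc i j (Subgroup.commutator_mem_commutator (hf.1 n) (hg.1 n)), ?_⟩
      -- The next value of `g` is the product of `g` and its derivative.
      have hg' := ihm _ _ _ hg.of_succ (hg.2.of_le hH (Nat.le_succ j))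
      have h₁ := ihc _ _ _ _ hf.2 hg'
      have h₂ := ihc _ _ _ _ hf.of_succ hg.2
      rw [show i + 1 + j = i + j + 1 by omega] at h₁
      have h₃ := ihm _ _ _
        (hconj' _ _ _ _ (hconj _ _ _ _ h₁ hf.of_succ) (ihc _ _ _ _ hf.of_succ hg.of_succ))
        (hconj _ _ _ _ h₂ hg.of_succ)
      convert h₃ using 2 with n
      simp only [commutatorElement_def]
      group

theorem isPolySeq_one (k i : ℕ) : IsPolySeq H k i fun _ => 1 := by
  induction k generalizing i with
  | zero => exact fun _ => one_mem _
  | succ k ih =>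
    refine ⟨fun _ => one_mem _, ?_⟩
    simpa using ih (i + 1)

theorem isPolySeq_pow_choose (hH : Antitone H) {g : G} (k : ℕ) {i m : ℕ} (hg : g ∈ H (i + m)) :
    IsPolySeq H k i fun n : ℕ => g ^ n.choose m := by
  induction k generalizing i m with
  | zero => exact fun n => pow_mem (hH (Nat.le_add_right i m) hg) _
  | succ k ih =>
    refine ⟨fun n => pow_mem (hH (Nat.le_add_right i m) hg) _, ?_⟩
    cases m with
    | zero => simpa using isPolySeq_one k (i + 1)
    | succ m =>
      rw [show i + (m + 1) = i + 1 + m by omega] at hg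
      convert ih hg using 2 with n
      beta_reduce
      rw [Nat.choose_succ_succ', add_comm (n.choose m), pow_add, inv_mul_cancel_left]

/-- If the values before `m` are trivial, the value at `m` is the `m`-th derivative at `0`. -/
theorem IsPolySeq.apply_mem {m i : ℕ} {f : ℕ → G} (hf : IsPolySeq H m i f)
    (h : ∀ n < m, f n = 1) : f m ∈ H (i + m) := by
  induction m generalizing i f with
  | zero => exact hf 0
  | succ m ih =>
    have := ih hf.2 fun n hn => by rw [h n (by omega), h (n + 1) (by omega), inv_one, one_mul]
    rw [h m (by omega), inv_one, one_mul] at this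
    rwa [show i + (m + 1) = i + 1 + m by omega]

theorem prime_pow_dvd_choose {p : ℕ} (hp : p.Prime) (k : ℕ) {m : ℕ} (h0 : 0 < m) (hm : m < p) :
    p ^ k ∣ (p ^ k).choose m := by
  obtain ⟨m, rfl⟩ := Nat.exists_eq_succ_of_ne_zero h0.ne'
  have hcop : Nat.Coprime (p ^ k) (m + 1) :=
    Nat.Coprime.pow_left k ((hp.coprime_iff_not_dvd).mpr (Nat.not_dvd_of_pos_of_lt h0 hm))
  refine hcop.dvd_of_dvd_mul_right (Dvd.intro ((p ^ k - 1).choose m) ?_)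
  have h := Nat.add_one_mul_choose_eq (p ^ k - 1) m
  rwa [Nat.sub_add_cancel (Nat.pow_pos hp.pos)] at h

/-- A polynomial sequence whose values at `0` and `1` are trivial is also trivial at `p ^ k`, if
`H p` is trivial and `H 2` has exponent dividing `p ^ k`. -/
theorem IsPolySeq.apply_prime_pow_eq_one (hH : Antitone H) (hc : ∀ i j, ⁅H i, H j⁆ ≤ H (i + j))
    {p : ℕ} (hp : p.Prime) (hbot : H p = ⊥) {k : ℕ} (hexp : ∀ g ∈ H 2, g ^ p ^ k = 1) {f : ℕ → G}
    (hf : ∀ d, IsPolySeq H d 0 f) (h0 : f 0 = 1) (h1 : f 1 = 1) : f (p ^ k) = 1 := by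
  -- If the first `m` values are trivial, dividing by `n ↦ f m ^ n.choose m` makes `f m` trivial
  -- too, and does not change the value at `p ^ k`. This is repeated until `m = p`.
  have key : ∀ d m, m + d = p → 2 ≤ m → ∀ f : ℕ → G, (∀ d, IsPolySeq H d 0 f) →
      (∀ n < m, f n = 1) → f (p ^ k) = 1 := by
    intro d
    induction d with
    | zero =>
      intro m hm _ f hf h
      have hall : ∀ n, f n = 1 := by
        intro n
        induction n using Nat.strong_induction_on with
        | _ n ihn =>
          rcases lt_or_ge n m with hn | hn
          · exact h n hn
          · have := hH (show p ≤ 0 + n by omega) ((hf n).apply_mem ihn)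
            rwa [hbot, Subgroup.mem_bot] at this
      exact hall _
    | succ d ih =>
      intro m hm hm2 f hf h
      have hg := (hf m).apply_mem h
      have hpoly : ∀ e, IsPolySeq H e 0 fun n : ℕ => f n * (f m ^ n.choose m)⁻¹ := fun e => by
        obtain ⟨hmul, hinv, -⟩ := isPolySeq_mul_inv_commutator hH hc e
        exact hmul _ _ _ (hf e) (hinv _ _ (isPolySeq_pow_choose hH e hg))
      have := ih (m + 1) (by omega) (by omega) _ hpoly fun n hn => by
        rcases Nat.lt_succ_iff_lt_or_eq.mp hn with hn | rfl
        · simp [h n hn, Nat.choose_eq_zero_of_lt hn]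
        · simp
      obtain ⟨t, ht⟩ := prime_pow_dvd_choose hp k (show 0 < m by omega) (show m < p by omega)
      rw [zero_add] at hg
      simpa [ht, pow_mul, hexp _ (hH hm2 hg)] using this
  refine key (p - 2) 2 (Nat.add_sub_cancel' hp.two_le) le_rfl f hf fun n hn => ?_
  interval_cases n
  · exact h0
  · exact h1

end Filtration

/-! ### Exponents of nilpotent groups of small class -/

theorem mul_prime_pow_eq {G : Type*} [Group G] {p : ℕ} (hp : p.Prime) (k : ℕ) {K : Subgroup G}
    (hK : K.lowerCentralSeries (p - 1) = ⊥) (hexp : ∀ g ∈ ⁅K, K⁆, g ^ p ^ k = 1) {a b : G}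
    (ha : a ∈ K) (hb : b ∈ K) : (a * b) ^ p ^ k = a ^ p ^ k * b ^ p ^ k := by
  -- By truncated subtraction the terms of index `0` and `1` are both `K`.
  let H : ℕ → Subgroup G := fun i => K.lowerCentralSeries (i - 1)
  have hH : Antitone H := fun i j hij => K.lowerCentralSeries_antitone (Nat.sub_le_sub_right hij 1)
  have hc : ∀ i j, ⁅H i, H j⁆ ≤ H (i + j) := by
    intro i j
    rcases Nat.eq_zero_or_pos i with rfl | hi
    · rw [zero_add, ← Subgroup.le_normalizer_iff_commutator_le_right]
      exact K.self_le_normalizer_lowerCentralSeries _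
    rcases Nat.eq_zero_or_pos j with rfl | hj
    · rw [add_zero, ← Subgroup.le_normalizer_iff_commutator_le_left]
      exact K.self_le_normalizer_lowerCentralSeries _
    · refine (commutator_lowerCentralSeries_le K _ _).trans
        (K.lowerCentralSeries_antitone (by omega))
  have hpow : ∀ c ∈ K, ∀ d, IsPolySeq H d 0 fun n => c ^ n := fun c hcK d => by
    simpa using isPolySeq_pow_choose (i := 0) (m := 1) hH d (show c ∈ H (0 + 1) from hcK)
  have hpoly : ∀ d, IsPolySeq H d 0 fun n => (a ^ n * b ^ n)⁻¹ * (a * b) ^ n := fun d => by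
    obtain ⟨hmul, hinv, -⟩ := isPolySeq_mul_inv_commutator hH hc d
    exact hmul _ _ _ (hinv _ _ (hmul _ _ _ (hpow a ha d) (hpow b hb d)))
      (hpow _ (mul_mem ha hb) d)
  have := IsPolySeq.apply_prime_pow_eq_one hH hc hp hK hexp hpoly (by simp) (by simp)
  exact (inv_mul_eq_one.mp this).symm

theorem pow_eq_one_of_mem_closure_of_commutator {G : Type*} [Group G] {p : ℕ} (hp : p.Prime)
    (k : ℕ) {S : Set G} (hS : ∀ x ∈ S, x ^ p ^ k = 1)
    (hK : (Subgroup.closure S).lowerCentralSeries (p - 1) = ⊥)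
    (hexp : ∀ g ∈ ⁅Subgroup.closure S, Subgroup.closure S⁆, g ^ p ^ k = 1) :
    ∀ g ∈ Subgroup.closure S, g ^ p ^ k = 1 := by
  intro g hg
  induction hg using Subgroup.closure_induction with
  | mem x hx => exact hS x hx
  | one => exact one_pow _
  | mul x y hx hy ihx ihy => rw [mul_prime_pow_eq hp k hK hexp hx hy, ihx, ihy, one_mul]
  | inv x _ ih => rw [inv_pow, ih, inv_one]

theorem commutator_closure_eq_closure {G : Type*} [Group G] (S : Set G) :
    ⁅Subgroup.closure S, Subgroup.closure S⁆ =
      Subgroup.closure {y | ∃ g ∈ Subgroup.closure S, ∃ x ∈ S, ⁅g, x⁆ = y} := by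
  set K := Subgroup.closure S
  set T := {y | ∃ g ∈ K, ∃ x ∈ S, ⁅g, x⁆ = y}
  refine le_antisymm ?_ ?_
  · have hconj : ∀ h ∈ K, ∀ y ∈ Subgroup.closure T, h * y * h⁻¹ ∈ Subgroup.closure T := by
      intro h hh y hy
      induction hy using Subgroup.closure_induction with
      | mem y hy =>
        obtain ⟨g, hg, x, hx, rfl⟩ := hy
        have key : h * ⁅g, x⁆ * h⁻¹ = ⁅h * g, x⁆ * ⁅h, x⁆⁻¹ := by
          simp only [commutatorElement_def]
          group
        rw [key]
        exact mul_mem (Subgroup.subset_closure ⟨_, mul_mem hh hg, x, hx, rfl⟩)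
          (inv_mem (Subgroup.subset_closure ⟨h, hh, x, hx, rfl⟩))
      | one => simp
      | mul y z _ _ ihy ihz =>
        rw [← conj_mul]
        exact mul_mem ihy ihz
      | inv y _ ih =>
        rw [← conj_inv]
        exact inv_mem ih
    rw [Subgroup.commutator_le]
    intro g hg y hy
    induction hy using Subgroup.closure_induction with
    | mem x hx => exact Subgroup.subset_closure ⟨g, hg, x, hx, rfl⟩
    | one => simp
    | mul y z hy _ ihy ihz =>
      rw [commutatorElement_mul_right_eq_mul_conj]
      simpa [mul_assoc] using mul_mem ihy (hconj y hy _ ihz)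
    | inv y hy ih =>
      have key : ⁅g, y⁻¹⁆ = y⁻¹ * ⁅g, y⁆⁻¹ * y⁻¹⁻¹ := by
        simp only [commutatorElement_def]
        group
      rw [key]
      exact hconj _ (inv_mem hy) _ (inv_mem ih)
  · rw [Subgroup.closure_le]
    rintro _ ⟨g, hg, x, hx, rfl⟩
    exact Subgroup.commutator_mem_commutator hg (Subgroup.subset_closure hx)

theorem pow_eq_one_of_mem_closure {G : Type*} [Group G] {p : ℕ} (hp : p.Prime) (k c : ℕ) :
    ∀ S : Set G, (∀ x ∈ S, x ^ p ^ k = 1) → (Subgroup.closure S).lowerCentralSeries c = ⊥ →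
      (c < p → ∀ g ∈ Subgroup.closure S, g ^ p ^ k = 1) ∧
      (c ≤ p → ∀ g ∈ ⁅Subgroup.closure S, Subgroup.closure S⁆, g ^ p ^ k = 1) := by
  induction c with
  | zero =>
    intro S _ hK
    have h : ∀ g ∈ Subgroup.closure S, g ^ p ^ k = 1 := fun g hg => by
      rw [Subgroup.lowerCentralSeries_zero] at hK
      rw [hK, Subgroup.mem_bot] at hg
      rw [hg, one_pow]
    exact ⟨fun _ => h, fun _ g hg => h g (Subgroup.commutator_le_self _ hg)⟩
  | succ c ih =>
    intro S hS hK
    suffices hexp : c + 1 ≤ p → ∀ g ∈ ⁅Subgroup.closure S, Subgroup.closure S⁆, g ^ p ^ k = 1 by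
      refine ⟨fun hcp => ?_, hexp⟩
      refine pow_eq_one_of_mem_closure_of_commutator hp k hS ?_ (hexp hcp.le)
      exact le_bot_iff.mp ((Subgroup.lowerCentralSeries_antitone _ (by omega)).trans hK.le)
    intro hcp
    cases c with
    | zero =>
      intro g hg
      have : g ∈ (Subgroup.closure S).lowerCentralSeries 1 := hg
      rw [hK, Subgroup.mem_bot] at this
      rw [this, one_pow]
    | succ c =>
      set K := Subgroup.closure S with hKdef
      have hsmall : ∀ x ∈ K, ∀ T : Set G, Subgroup.closure T ≤ Subgroup.zpowers x ⊔ ⁅K, K⁆ →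
          (∀ y ∈ T, y ^ p ^ k = 1) → ∀ y ∈ Subgroup.closure T, y ^ p ^ k = 1 := by
        intro x hx T hT hpow
        refine (ih T hpow (le_bot_iff.mp ?_)).1 (by omega)
        exact ((Subgroup.lowerCentralSeries_mono _ hT).trans
          (lowerCentralSeries_zpowers_sup_le hx c)).trans hK.le
      have hcomm := commutator_closure_eq_closure S
      rw [← hKdef] at hcomm
      rw [hcomm]
      refine hsmall 1 (one_mem K) _ (hcomm ▸ le_sup_right) ?_
      rintro _ ⟨g, hg, x, hx, rfl⟩
      have hxK : x ∈ K := Subgroup.subset_closure hx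
      refine hsmall x hxK {g * x * g⁻¹, x⁻¹} ?_ ?_ _ ?_
      · have hxM : x ∈ Subgroup.zpowers x ⊔ ⁅K, K⁆ :=
          Subgroup.mem_sup_left (Subgroup.mem_zpowers x)
        rw [Subgroup.closure_le]
        rintro y (rfl | rfl)
        · rw [SetLike.mem_coe, show g * x * g⁻¹ = ⁅g, x⁆ * x by simp [commutatorElement_def]]
          exact mul_mem (Subgroup.mem_sup_right (Subgroup.commutator_mem_commutator hg hxK)) hxM
        · exact inv_mem hxM
      · rintro y (rfl | rfl)
        · rw [conj_pow, hS x hx, mul_one, mul_inv_cancel]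
        · rw [inv_pow, hS x hx, inv_one]
      · exact mul_mem (Subgroup.subset_closure (Or.inl rfl)) (Subgroup.subset_closure (Or.inr rfl))

theorem pow_eq_one_of_mem_commutator {G : Type*} [Group G] [Group.IsNilpotent G] {p : ℕ}
    (hp : p.Prime) (hc : Group.nilpotencyClass G ≤ p) (k : ℕ) {S : Set G}
    (hgen : Subgroup.closure S = ⊤) (hS : ∀ x ∈ S, x ^ p ^ k = 1) :
    ∀ g ∈ commutator G, g ^ p ^ k = 1 := by
  have hbot : (Subgroup.closure S).lowerCentralSeries p = ⊥ := by
    rw [hgen]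
    exact Subgroup.lowerCentralSeries_eq_bot_iff_nilpotencyClass_le.mpr hc
  have hexp := (pow_eq_one_of_mem_closure hp k p S hS hbot).2 le_rfl
  rwa [hgen] at hexp

theorem generatorExponent_dvd_card (G : Type*) [Group G] [Finite G] :
    generatorExponent G ∣ Nat.card G := by
  obtain ⟨S, -, h⟩ := exists_generatorExponent_eq G
  rw [h]
  exact Finset.lcm_dvd fun x _ => orderOf_dvd_natCard x

theorem lemma4p4 (p : ℕ) (hp : p.Prime) (G : Type*) [Group G] [Finite G]
    (hG : IsPGroup p G) (hc : Group.nilpotencyClass G ≤ p) :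
    Monoid.exponent (commutator G) ∣ generatorExponent G := by
  have : Fact p.Prime := ⟨hp⟩
  have : Group.IsNilpotent G := hG.isNilpotent
  obtain ⟨n, hn⟩ := IsPGroup.iff_card.mp hG
  obtain ⟨k, -, hk⟩ := (Nat.dvd_prime_pow hp).mp ((generatorExponent_dvd_card G).trans hn.dvd)
  obtain ⟨S, hS, he⟩ := exists_generatorExponent_eq G
  have hpow : ∀ x ∈ (S : Set G), x ^ p ^ k = 1 := fun x hx => by
    rw [← orderOf_dvd_iff_pow_eq_one, ← hk, he]
    exact Finset.dvd_lcm hx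
  rw [hk]
  exact Monoid.exponent_dvd_of_forall_pow_eq_one fun g =>
    Subtype.ext (pow_eq_one_of_mem_commutator hp hc k hS hpow g g.2)
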